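/- Consider a task of size $\ell>0$ that starts at time $0$ and is processed at rate $r(t)$ at time $t$, where $r:[0,\infty)\to[0,\infty)$ is continuous, $r(t)>0$ for $t>0$, and $R(t)=\int_0^t r(s)\,ds\to\infty$ as $t\to\infty$. Failures occur at the epochs $0<T_1^*<T_2^*<\cdots$ of a homogeneous Poisson process of constant rate $\mu^*\in(0,\infty)$; put $T_0^*=0$. At every failure epoch the task, if not yet completed, is restarted from scratch (RESTART). Thus the attempt started at $T_n^*$ succeeds if and only if $R(T_{n+1}^*)-R(T_n^*)\ge \ell$. Let $$D^*=\min\{T_n^*:\ n\ge 0,\ R(T_{n+1}^*)-R(T_n^*)\ge \ell\}$$ (with $D^*=\infty$ if there is no such $n$) be the delay, i.e. the total duration of the unsuccessful attempts, and let $X^*$ be the total time until completion, i.e. the first time $t$ for which there is an $n\ge 0$ with $T_n^*\le t\le T_{n+1}^*$ and $R(t)-R(T_n^*)\ge \ell$ (with $X^*=\infty$ if there is no such $t$). For eventually positive functions write $f(t)\approx_{\log} g(t)$ if $\log f(t)/\log g(t)\to 1$ as $t\to\infty$. (i) If $\limsup_{t\to\infty}\dfrac{\mu^*}{r(t)\log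 R(t)}<\dfrac1\ell$, then $X^*<\infty$ almost surely. If $\liminf_{t\to\infty}\dfrac{\mu^*}{r(t)\log R(t)}>\dfrac1\ell$ (the value $+\infty$ being allowed), then $\mathbb P(X^*=\infty)>0$. (ii) If $r(t)=a t^b$ for all $t\ge 0$ with constants $a>0$ and $b>0$, then $$\mathbb P(X^*>t)\ \approx_{\log}\ \mathbb P(D^*>t)\ \approx_{\log}\ \exp\Bigl(-\frac{ab}{(b+1)\,\ell}\,t^{b+1}\log t\Bigr).$$ -/

import Mathlib

open MeasureTheory ProbabilityTheory Filter Topology Set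
open scoped NNReal ENNReal

/-- The number of indices `n` with `a < T n ≤ b`, for a sequence of epochs `T`. -/
noncomputable def epochCount (T : ℕ → ℝ) (a b : ℝ) : ℕ :=
  Set.ncard {n : ℕ | T n ∈ Set.Ioc a b}

/-- `0 = T 0 < T 1 < T 2 < ⋯` are the (random) epochs of a homogeneous Poisson process on
`(0, ∞)` with the given rate, where `T 0 = 0` is a convention and not an epoch: almost surely the
epochs increase strictly to infinity, the number of epochs in `(s, t]` is Poisson distributed with
mean `rate * (t - s)`, and the numbers of epochs in successive intervals are independent. -/
structure IsPoissonProcess {Ω : Type*} [MeasurableSpace Ω] (rate : ℝ) (T : ℕ → Ω → ℝ)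
    (P : Measure Ω) : Prop where
  measurable : ∀ n, Measurable (T n)
  zero : ∀ ω, T 0 ω = 0
  strictMono : ∀ᵐ ω ∂P, StrictMono fun n => T n ω
  tendsto_atTop : ∀ᵐ ω ∂P, Tendsto (fun n => T n ω) atTop atTop
  hasLaw_count : ∀ s t : ℝ, 0 ≤ s → s ≤ t →
    HasLaw (fun ω => epochCount (fun n => T n ω) s t)
      (poissonMeasure (Real.toNNReal (rate * (t - s)))) P
  indep_count : ∀ t : ℕ → ℝ, 0 ≤ t 0 → Monotone t →
    iIndepFun (fun (i : ℕ) ω => epochCount (fun n => T n ω) (t i) (t (i + 1))) P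

/-- `R(t) = ∫₀ᵗ r(s) ds`, the work that can be processed up to time `t` at the rate `r`. -/
noncomputable def work (r : ℝ → ℝ) (t : ℝ) : ℝ := ∫ s in (0 : ℝ)..t, r s

/-- The delay of a task of size `ℓ` which is restarted from scratch at each of the failure epochs
`0 = T 0 < T 1 < T 2 < ⋯` (time `0` being the first start): the first start `T n` of an attempt
during which, before the next failure `T (n + 1)`, at least the work `ℓ` is processed. It is also
the total duration of the unsuccessful attempts, and it is `⊤` if all attempts fail. -/
noncomputable def restartDelay (r : ℝ → ℝ) (ℓ : ℝ) (T : ℕ → ℝ) : EReal :=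
  ⨅ (n : ℕ) (_ : ℓ ≤ work r (T (n + 1)) - work r (T n)), ((T n : ℝ) : EReal)

/-- The total time until completion of the task of size `ℓ` which is restarted from scratch at each
of the failure epochs `T n`: the first time `t` such that, in the attempt under way up to `t`, the
work processed since the start of that attempt has reached `ℓ`. It is `⊤` if this never happens. -/
noncomputable def restartTime (r : ℝ → ℝ) (ℓ : ℝ) (T : ℕ → ℝ) : EReal :=
  ⨅ (t : ℝ) (_ : ∃ n : ℕ, T n ≤ t ∧ t ≤ T (n + 1) ∧ ℓ ≤ work r t - work r (T n)),
    ((t : ℝ) : EReal)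

/-- Logarithmic asymptotics `f ≈_log g` at infinity, i.e. `log f(t) / log g(t) → 1`,
for functions that are eventually positive. -/
def LogAsymp (f g : ℝ → ℝ) : Prop :=
  (∀ᶠ t in atTop, 0 < f t) ∧ (∀ᶠ t in atTop, 0 < g t) ∧
    Tendsto (fun t => Real.log (f t) / Real.log (g t)) atTop (𝓝 1)

/-! ### Sample paths -/

/-! Time is cut at the points `x k` where the processed work equals `k * ε`. The cells `(x k, x (k +
1)]` carry equal work, their epoch counts are independent, and a cell of length `d` is empty with
probability `exp (-(rate * d))`. Two deterministic facts turn the problem into one about empty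
cells. With `ε = ℓ`, an empty cell lets the attempt under way finish
(`restartTime_le_of_epochCount_eq_zero`). With `ε = ℓ / (p + 1)`, a successful attempt contains `p`
consecutive empty cells (`exists_empty_cells`).

For (i), bounds on `r * log R` make the emptiness probabilities comparable with powers of `k`. Below
the threshold they are at least a multiple of `1 / k`, and the second Borel–Cantelli lemma gives an
empty cell almost surely. Above it, runs of `p` empty cells have summable probabilities once `p` is
large, and with positive probability none occurs.

For (ii), a cell near time `t` has length of order `t ^ (-b)`, hence is nonempty with probability of
that order. `X > t` forces about `R(t) / ℓ` cells to be nonempty. Conversely, `D > t` holds as soon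
as every `p`-th cell is nonempty a little beyond `t`, which concerns about `(1 + 1 / p) * R(t) / ℓ`
cells. Each cell contributes `-b log t` to the logarithm; since `D ≤ X`, both tails are squeezed as
`p → ∞`. -/

theorem epochCount_eq_zero_iff {τ : ℕ → ℝ} (hτ : Tendsto τ atTop atTop) (a b : ℝ) :
    epochCount τ a b = 0 ↔ ∀ n, τ n ∉ Ioc a b := by
  have hfin : {n : ℕ | τ n ∈ Ioc a b}.Finite := by
    obtain ⟨N, hN⟩ := (hτ.eventually_gt_atTop b).exists_forall_of_atTop
    refine (finite_lt_nat N).subset fun n hn => ?_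
    by_contra h
    exact (hN n (not_lt.1 h)).not_ge hn.2
  rw [epochCount, ncard_eq_zero hfin, eq_empty_iff_forall_notMem]
  rfl

theorem exists_le_lt_succ {τ : ℕ → ℝ} (h0 : τ 0 = 0) (hτ : Tendsto τ atTop atTop) {s : ℝ}
    (hs : 0 ≤ s) : ∃ n, τ n ≤ s ∧ s < τ (n + 1) := by
  classical
  have hex : ∃ n, s < τ n := (hτ.eventually_gt_atTop s).exists
  obtain ⟨n, hn⟩ := Nat.exists_eq_succ_of_ne_zero
    (show Nat.find hex ≠ 0 from fun h => by
      have := Nat.find_spec hex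
      rw [h, h0] at this
      exact this.not_ge hs)
  refine ⟨n, not_lt.1 (Nat.find_min hex (by omega)), ?_⟩
  have := Nat.find_spec hex
  rwa [hn] at this

theorem restartTime_le_of_epochCount_eq_zero {r : ℝ → ℝ} {ℓ : ℝ} {τ : ℕ → ℝ}
    (hw : StrictMonoOn (work r) (Ici 0)) (h0 : τ 0 = 0) (hmono : StrictMono τ)
    (hτ : Tendsto τ atTop atTop) {s t : ℝ} (hs : 0 ≤ s) (hst : s ≤ t)
    (hℓ : ℓ ≤ work r t - work r s) (hcount : epochCount τ s t = 0) :
    restartTime r ℓ τ ≤ t := by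
  obtain ⟨n, hn, hn'⟩ := exists_le_lt_succ h0 hτ hs
  have hpos : 0 ≤ τ n := h0 ▸ hmono.monotone (Nat.zero_le n)
  have ht : t < τ (n + 1) := by
    by_contra h
    exact (epochCount_eq_zero_iff hτ s t).1 hcount (n + 1) ⟨hn', not_lt.1 h⟩
  have := hw.monotoneOn hpos hs hn
  exact iInf₂_le t ⟨n, hn.trans hst, ht.le, by linarith⟩

theorem restartDelay_le_restartTime {r : ℝ → ℝ} {ℓ : ℝ} {τ : ℕ → ℝ}
    (hw : StrictMonoOn (work r) (Ici 0)) (h0 : τ 0 = 0) (hmono : StrictMono τ) :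
    restartDelay r ℓ τ ≤ restartTime r ℓ τ := by
  refine le_iInf₂ fun t ⟨n, h1, h2, h3⟩ => ?_
  have hpos : 0 ≤ τ n := h0 ▸ hmono.monotone (Nat.zero_le n)
  have := hw.monotoneOn (show (0 : ℝ) ≤ t from hpos.trans h1)
    (show (0 : ℝ) ≤ τ (n + 1) from hpos.trans (h1.trans h2)) h2
  exact (iInf₂_le n (by linarith)).trans (EReal.coe_le_coe_iff.2 h1)

/-- Rounding the start of the attempt up to the mesh loses less than `ε` of work, so `p` whole cells
remain. The loss is strictly less than `ε`, so the last cell ends strictly before the failure at `τ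
(n + 1)`; the cells being open on the left, `τ n` is excluded too. -/
theorem exists_empty_cells {r : ℝ → ℝ} {τ : ℕ → ℝ}
    (hw : StrictMonoOn (work r) (Ici 0)) (hw0 : work r 0 = 0) (h0 : τ 0 = 0) (hmono : StrictMono τ)
    (hτ : Tendsto τ atTop atTop) {ε : ℝ} (hε : 0 < ε) {x : ℕ → ℝ} (hx : ∀ k, 0 ≤ x k)
    (hxw : ∀ k, work r (x k) = k * ε) {p n : ℕ}
    (hn : (p + 1) * ε ≤ work r (τ (n + 1)) - work r (τ n)) :
    ∃ k : ℕ, k * ε < work r (τ n) + ε ∧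
      ∀ j < p, epochCount τ (x (k + j)) (x (k + j + 1)) = 0 := by
  have hpos : ∀ i, 0 ≤ τ i := fun i => h0 ▸ hmono.monotone (Nat.zero_le i)
  have hwpos : 0 ≤ work r (τ n) := by
    rw [← hw0]; exact hw.monotoneOn self_mem_Ici (hpos n) (hpos n)
  have h1 := Nat.le_ceil (work r (τ n) / ε)
  have h2 := Nat.ceil_lt_add_one (div_nonneg hwpos hε.le)
  set k := ⌈work r (τ n) / ε⌉₊
  rw [div_le_iff₀ hε] at h1
  have h2 : k * ε < work r (τ n) + ε := by
    have := mul_lt_mul_of_pos_right h2 hε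
    rwa [add_mul, div_mul_cancel₀ _ hε.ne', one_mul] at this
  refine ⟨k, h2, fun j hj => (epochCount_eq_zero_iff hτ _ _).2 fun i hi => ?_⟩
  have a1 := hw (hx _) (hpos i) hi.1
  have a2 := hw.monotoneOn (hpos i) (hx _) hi.2
  rw [hxw] at a1 a2
  push_cast at a1 a2
  rcases le_or_gt i n with hin | hin
  · have := hw.monotoneOn (hpos i) (hpos n) (hmono.monotone hin)
    nlinarith [mul_nonneg (Nat.cast_nonneg (α := ℝ) j) hε.le]
  · have := hw.monotoneOn (hpos (n + 1)) (hpos i) (hmono.monotone hin)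
    have hj' : (j : ℝ) + 1 ≤ p := by exact_mod_cast hj
    nlinarith [mul_le_mul_of_nonneg_right hj' hε.le]

theorem exists_success_of_restartTime_ne_top {r : ℝ → ℝ} {ℓ : ℝ} {τ : ℕ → ℝ}
    (hw : StrictMonoOn (work r) (Ici 0)) (h0 : τ 0 = 0) (hmono : StrictMono τ)
    (h : restartTime r ℓ τ ≠ ⊤) : ∃ n, ℓ ≤ work r (τ (n + 1)) - work r (τ n) := by
  contrapose! h
  refine top_unique (le_iInf₂ fun t ⟨n, h1, h2, h3⟩ => ?_)
  have hpos : 0 ≤ τ n := h0 ▸ hmono.monotone (Nat.zero_le n)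
  have := hw.monotoneOn (show (0 : ℝ) ≤ t from hpos.trans h1)
    (show (0 : ℝ) ≤ τ (n + 1) from hpos.trans (h1.trans h2)) h2
  linarith [h n]

/-- Among any `p` consecutive indices one is a multiple of `p`, so it suffices to prevent emptiness
in every `p`-th cell. This saving makes the lower bound on the tail sharp. -/
theorem le_restartDelay_of_cells_nonempty {r : ℝ → ℝ} {τ : ℕ → ℝ}
    (hw : StrictMonoOn (work r) (Ici 0)) (hw0 : work r 0 = 0) (h0 : τ 0 = 0) (hmono : StrictMono τ)
    (hτ : Tendsto τ atTop atTop) {ε : ℝ} (hε : 0 < ε) {x : ℕ → ℝ} (hx : ∀ k, 0 ≤ x k)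
    (hxw : ∀ k, work r (x k) = k * ε) {p : ℕ} (hp : 0 < p) {K : ℕ}
    (hK : ∀ i ≤ K, epochCount τ (x (i * p)) (x (i * p + 1)) ≠ 0) :
    ((x (K * p) : ℝ) : EReal) ≤ restartDelay r ((p + 1) * ε) τ := by
  refine le_iInf₂ fun n hn => EReal.coe_le_coe_iff.2 ?_
  obtain ⟨k, hk, hcell⟩ := exists_empty_cells hw hw0 h0 hmono hτ hε hx hxw hn
  have hpos : 0 ≤ τ n := h0 ▸ hmono.monotone (Nat.zero_le n)
  refine (hw.le_iff_le (hx _) hpos).1 ?_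
  have hkK : K * p < k := by
    by_contra hle
    rw [not_lt] at hle
    -- `i * p` is the first multiple of `p` that is at least `k`.
    obtain ⟨i, j, hj, hij⟩ : ∃ i j, j < p ∧ k + j = i * p := by
      refine ⟨(k + p - 1) / p, (k + p - 1) / p * p - k, ?_, ?_⟩ <;>
      · have e1 := Nat.div_add_mod (k + p - 1) p
        have e2 := Nat.mod_lt (k + p - 1) hp
        rw [mul_comm] at e1
        omega
    refine hK i ?_ (hij ▸ hcell j hj)
    by_contra hi
    have : (K + 1) * p ≤ i * p := Nat.mul_le_mul_right p (by omega)
    have e : (K + 1) * p = K * p + p := by ring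
    omega
  have : ((K * p : ℕ) : ℝ) + 1 ≤ k := by exact_mod_cast hkK
  rw [hxw]
  nlinarith

/-! ### Counts of epochs -/

section Counts

variable {Ω : Type*} [MeasurableSpace Ω] {P : Measure Ω} {rate : ℝ} {T : ℕ → Ω → ℝ}

theorem measurable_epochCount (hT : ∀ n, Measurable (T n)) (a b : ℝ) :
    Measurable fun ω => epochCount (fun n => T n ω) a b := by
  -- No almost sure finiteness is needed: for infinitely many epochs both `ncard` and
  -- `ENNReal.toReal` return `0`.
  have key : (fun ω => epochCount (fun n => T n ω) a b) = fun ω =>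
      ⌊(∑' n, (T n ⁻¹' Ioc a b).indicator (fun _ => (1 : ℝ≥0∞)) ω).toReal⌋₊ := by
    funext ω
    have h1 : ∑' n, (T n ⁻¹' Ioc a b).indicator (fun _ => (1 : ℝ≥0∞)) ω =
        ({n : ℕ | T n ω ∈ Ioc a b}.encard : ℝ≥0∞) := by
      rw [← ENNReal.tsum_set_one, tsum_subtype {n : ℕ | T n ω ∈ Ioc a b} fun _ => (1 : ℝ≥0∞)]
      rfl
    rw [h1, epochCount, ncard_def]
    generalize {n : ℕ | T n ω ∈ Ioc a b}.encard = e
    induction e using ENat.recTopCoe <;> simp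
  rw [key]
  exact Nat.measurable_floor.comp (Measurable.tsum fun n =>
    measurable_const.indicator (hT n measurableSet_Ioc)).ennreal_toReal

theorem IsPoissonProcess.measure_epochCount_eq_zero (hT : IsPoissonProcess rate T P)
    (hrate : 0 ≤ rate) {s t : ℝ} (hs : 0 ≤ s) (hst : s ≤ t) :
    P ((fun ω => epochCount (fun n => T n ω) s t) ⁻¹' {0}) =
      ENNReal.ofReal (Real.exp (-(rate * (t - s)))) := by
  have h := hT.hasLaw_count s t hs hst
  rw [← Measure.map_apply_of_aemeasurable h.aemeasurable (measurableSet_singleton 0), h.map_eq,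
    poissonMeasure_singleton,
    Real.coe_toNNReal _ (mul_nonneg hrate (sub_nonneg.2 hst))]
  simp

theorem IsPoissonProcess.measure_epochCount_ne_zero [IsProbabilityMeasure P]
    (hT : IsPoissonProcess rate T P)
    (hrate : 0 ≤ rate) {s t : ℝ} (hs : 0 ≤ s) (hst : s ≤ t) :
    P ((fun ω => epochCount (fun n => T n ω) s t) ⁻¹' {0}ᶜ) =
      ENNReal.ofReal (1 - Real.exp (-(rate * (t - s)))) := by
  rw [preimage_compl, prob_compl_eq_one_sub
    (measurable_epochCount hT.measurable s t (measurableSet_singleton 0)),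
    hT.measure_epochCount_eq_zero hrate hs hst, ENNReal.ofReal_sub _ (Real.exp_pos _).le,
    ENNReal.ofReal_one]

theorem IsPoissonProcess.measureReal_biInter_epochCount_ne_zero [IsProbabilityMeasure P]
    (hT : IsPoissonProcess rate T P) (hrate : 0 ≤ rate) {x : ℕ → ℝ} (hx : 0 ≤ x 0)
    (hxm : Monotone x) (S : Finset ℕ) :
    P.real (⋂ k ∈ S, (fun ω => epochCount (fun n => T n ω) (x k) (x (k + 1))) ⁻¹' {0}ᶜ) =
      ∏ k ∈ S, (1 - Real.exp (-(rate * (x (k + 1) - x k)))) := by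
  rw [measureReal_def, (hT.indep_count x hx hxm).measure_inter_preimage_eq_mul S
    (fun _ _ => (measurableSet_singleton 0).compl), ENNReal.toReal_prod]
  refine Finset.prod_congr rfl fun k _ => ?_
  have hk : x k ≤ x (k + 1) := hxm k.le_succ
  rw [hT.measure_epochCount_ne_zero hrate (hx.trans (hxm (Nat.zero_le k))) hk,
    ENNReal.toReal_ofReal]
  rw [sub_nonneg, Real.exp_le_one_iff]
  exact neg_nonpos.2 (mul_nonneg hrate (sub_nonneg.2 hk))

end Counts

/-! ### The work function -/

section Work

variable {r : ℝ → ℝ}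

theorem work_zero : work r 0 = 0 := intervalIntegral.integral_same

theorem intervalIntegrable_of_continuousOn_Ici (hr : ContinuousOn r (Ici 0)) {s t : ℝ}
    (hs : 0 ≤ s) (ht : 0 ≤ t) : IntervalIntegrable r volume s t :=
  (hr.mono fun _ hu => (le_inf hs ht).trans hu.1).intervalIntegrable

theorem work_sub_work (hr : ContinuousOn r (Ici 0)) {s t : ℝ} (hs : 0 ≤ s) (ht : 0 ≤ t) :
    work r t - work r s = ∫ u in s..t, r u :=
  intervalIntegral.integral_interval_sub_left
    (intervalIntegrable_of_continuousOn_Ici hr le_rfl ht)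
    (intervalIntegrable_of_continuousOn_Ici hr le_rfl hs)

theorem strictMonoOn_work (hr : ContinuousOn r (Ici 0)) (hpos : ∀ t, 0 < t → 0 < r t) :
    StrictMonoOn (work r) (Ici 0) := by
  intro s hs t ht hst
  rw [← sub_pos, work_sub_work hr hs ht]
  exact intervalIntegral.intervalIntegral_pos_of_pos_on
    (intervalIntegrable_of_continuousOn_Ici hr hs ht)
    (fun u hu => hpos u (lt_of_le_of_lt hs hu.1)) hst

theorem work_sub_work_le (hr : ContinuousOn r (Ici 0)) {s t M : ℝ} (hs : 0 ≤ s) (hst : s ≤ t)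
    (hM : ∀ u ∈ Icc s t, r u ≤ M) : work r t - work r s ≤ M * (t - s) := by
  rw [work_sub_work hr hs (hs.trans hst)]
  refine (intervalIntegral.integral_mono_on hst
    (intervalIntegrable_of_continuousOn_Ici hr hs (hs.trans hst)) intervalIntegrable_const hM).trans
    ?_
  simp [mul_comm]

theorem le_work_sub_work (hr : ContinuousOn r (Ici 0)) {s t M : ℝ} (hs : 0 ≤ s) (hst : s ≤ t)
    (hM : ∀ u ∈ Icc s t, M ≤ r u) : M * (t - s) ≤ work r t - work r s := by
  rw [work_sub_work hr hs (hs.trans hst)]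
  refine le_trans ?_ (intervalIntegral.integral_mono_on hst intervalIntegrable_const
    (intervalIntegrable_of_continuousOn_Ici hr hs (hs.trans hst)) hM)
  simp [mul_comm]

theorem exists_work_eq (hr : ContinuousOn r (Ici 0)) (hint : Tendsto (work r) atTop atTop)
    {y : ℝ} (hy : 0 ≤ y) : ∃ t, 0 ≤ t ∧ work r t = y := by
  obtain ⟨B, hB, hB0⟩ := ((hint.eventually_ge_atTop y).and (eventually_ge_atTop 0)).exists
  have hc : ContinuousOn (work r) (Icc 0 B) := by
    have := intervalIntegral.continuousOn_primitive_interval (a := 0) (b := B) (f := r)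
      (μ := volume) (by
        rw [uIcc_of_le hB0]
        exact (hr.mono fun u hu => hu.1).integrableOn_Icc)
    rwa [uIcc_of_le hB0] at this
  obtain ⟨t, ht, hty⟩ := intermediate_value_Icc hB0 hc ⟨by rw [work_zero]; exact hy, hB⟩
  exact ⟨t, ht.1, hty⟩

/-- The times `x 0 < x 1 < ⋯` at which the processed work is a multiple of `ε`. -/
structure IsWorkMesh (r : ℝ → ℝ) (ε : ℝ) (x : ℕ → ℝ) : Prop where
  strictMonoOn : StrictMonoOn (work r) (Ici 0)
  pos : 0 < ε
  nonneg : ∀ k, 0 ≤ x k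
  work_eq : ∀ k, work r (x k) = k * ε

theorem exists_isWorkMesh (hr : ContinuousOn r (Ici 0)) (hpos : ∀ t, 0 < t → 0 < r t)
    (hint : Tendsto (work r) atTop atTop) {ε : ℝ} (hε : 0 < ε) : ∃ x, IsWorkMesh r ε x := by
  choose x hx0 hx using fun k : ℕ =>
    exists_work_eq hr hint (mul_nonneg (Nat.cast_nonneg k) hε.le)
  exact ⟨x, strictMonoOn_work hr hpos, hε, hx0, hx⟩

namespace IsWorkMesh

variable {ε : ℝ} {x : ℕ → ℝ}

theorem strictMono (h : IsWorkMesh r ε x) : StrictMono x := by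
  refine strictMono_nat_of_lt_succ fun k => ?_
  rw [← h.strictMonoOn.lt_iff_lt (h.nonneg _) (h.nonneg _), h.work_eq, h.work_eq]
  push_cast
  linarith [h.pos]

theorem work_sub (h : IsWorkMesh r ε x) (k : ℕ) : work r (x (k + 1)) - work r (x k) = ε := by
  rw [h.work_eq, h.work_eq]
  push_cast
  ring

theorem le_iff (h : IsWorkMesh r ε x) {t : ℝ} (ht : 0 ≤ t) (k : ℕ) :
    t ≤ x k ↔ work r t ≤ k * ε := by
  rw [← h.work_eq, h.strictMonoOn.le_iff_le ht (h.nonneg k)]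

theorem ge_iff (h : IsWorkMesh r ε x) {t : ℝ} (ht : 0 ≤ t) (k : ℕ) :
    x k ≤ t ↔ k * ε ≤ work r t := by
  rw [← h.work_eq, h.strictMonoOn.le_iff_le (h.nonneg k) ht]

theorem tendsto_atTop (h : IsWorkMesh r ε x) : Tendsto x atTop atTop := by
  refine Filter.tendsto_atTop.2 fun B => ?_
  have : Tendsto (fun k : ℕ => (k : ℝ) * ε) atTop atTop :=
    tendsto_natCast_atTop_atTop.atTop_mul_const h.pos
  filter_upwards [this.eventually_ge_atTop (work r (max B 0))] with k hk
  exact (le_max_left B 0).trans ((h.le_iff (le_max_right B 0) k).2 hk)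

end IsWorkMesh

end Work

/-! ### Finiteness of the completion time -/

section Finiteness

variable {Ω : Type*} [MeasurableSpace Ω] {P : Measure Ω}
  {ℓ rate : ℝ} {T : ℕ → Ω → ℝ} {r : ℝ → ℝ}

theorem iIndepSet_epochCount_eq_zero (hT : IsPoissonProcess rate T P) {x : ℕ → ℝ} (hx : 0 ≤ x 0)
    (hxm : Monotone x) :
    iIndepSet (fun k => (fun ω => epochCount (fun n => T n ω) (x k) (x (k + 1))) ⁻¹' {0}) P := by
  rw [iIndepSet_iff_meas_biInter fun k =>
    measurable_epochCount hT.measurable _ _ (measurableSet_singleton 0)]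
  exact fun S => (hT.indep_count x hx hxm).measure_inter_preimage_eq_mul S
    (fun _ _ => measurableSet_singleton 0)

theorem measureReal_epochCount_eq_zero (hT : IsPoissonProcess rate T P) (hrate : 0 ≤ rate)
    {s t : ℝ} (hs : 0 ≤ s) (hst : s ≤ t) :
    P.real ((fun ω => epochCount (fun n => T n ω) s t) ⁻¹' {0}) =
      Real.exp (-(rate * (t - s))) := by
  rw [measureReal_def, hT.measure_epochCount_eq_zero hrate hs hst,
    ENNReal.toReal_ofReal (Real.exp_pos _).le]

variable [IsProbabilityMeasure P]

theorem ae_restartTime_lt_top (hℓ : 0 < ℓ) (hrate : 0 < rate) (hT : IsPoissonProcess rate T P)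
    (hr : ContinuousOn r (Ici 0)) (hpos : ∀ t, 0 < t → 0 < r t)
    (hint : Tendsto (work r) atTop atTop)
    (hlim : ∀ᶠ t in atTop, rate / (r t * Real.log (work r t)) < 1 / ℓ) :
    ∀ᵐ ω ∂P, restartTime r ℓ (fun n => T n ω) < ⊤ := by
  obtain ⟨x, hx⟩ := exists_isWorkMesh hr hpos hint hℓ
  have hx0 := hx.nonneg 0
  have hxm := hx.strictMono.monotone
  set F : ℕ → Set Ω := fun k => (fun ω => epochCount (fun n => T n ω) (x k) (x (k + 1))) ⁻¹' {0}
  have hFm : ∀ k, MeasurableSet (F k) := fun k =>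
    measurable_epochCount hT.measurable _ _ (measurableSet_singleton 0)
  have hFr : ∀ k, P.real (F k) = Real.exp (-(rate * (x (k + 1) - x k))) := fun k =>
    measureReal_epochCount_eq_zero hT hrate.le (hx.nonneg k) (hxm k.le_succ)
  obtain ⟨U, hU⟩ := ((hlim.and (hint.eventually_gt_atTop 1)).and
    (eventually_gt_atTop 0)).exists_forall_of_atTop
  have hlow : ∀ᶠ k : ℕ in atTop, 1 / (((k + 1 : ℕ) : ℝ)) ≤ ℓ * P.real (F k) := by
    filter_upwards [hx.tendsto_atTop.eventually_ge_atTop U] with k hk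
    have hk1 : x k ≤ x (k + 1) := hxm k.le_succ
    obtain ⟨⟨-, hW⟩, -⟩ := hU (x (k + 1)) (hk.trans hk1)
    have hlog : 0 < Real.log (work r (x (k + 1))) := Real.log_pos hW
    -- Taking the logarithm at the right end of the cell makes the bound uniform in `u`; there the
    -- work is exactly `(k + 1) * ℓ`.
    have hbound : ∀ u ∈ Icc (x k) (x (k + 1)),
        rate * ℓ / Real.log (work r (x (k + 1))) ≤ r u := by
      intro u hu
      obtain ⟨⟨h1, h2⟩, h3⟩ := hU u (hk.trans hu.1)
      have hl := Real.log_pos h2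
      have hru := hpos u h3
      rw [div_lt_div_iff₀ (mul_pos hru hl) hℓ, one_mul] at h1
      rw [div_le_iff₀ hlog]
      refine h1.le.trans (mul_le_mul_of_nonneg_left ?_ hru.le)
      exact Real.log_le_log (by linarith)
        (hx.strictMonoOn.monotoneOn h3.le (hx.nonneg _) hu.2)
    have h := le_work_sub_work hr (hx.nonneg k) hk1 hbound
    rw [hx.work_sub, div_mul_eq_mul_div, div_le_iff₀ hlog] at h
    have hd : rate * (x (k + 1) - x k) ≤ Real.log (work r (x (k + 1))) := by nlinarith
    rw [hFr]
    have h' := Real.exp_le_exp.2 (neg_le_neg hd)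
    rw [Real.exp_neg, Real.exp_log (by linarith), hx.work_eq] at h'
    have hk0 : (0 : ℝ) < ((k + 1 : ℕ) : ℝ) := by positivity
    calc 1 / ((k + 1 : ℕ) : ℝ) = ℓ * (((k + 1 : ℕ) : ℝ) * ℓ)⁻¹ := by field_simp
      _ ≤ _ := mul_le_mul_of_nonneg_left h' hℓ.le
  have hsum : ∑' k, P (F k) = ⊤ := by
    by_contra hne
    have hs : Summable fun k => ℓ * P.real (F k) := (ENNReal.summable_toReal hne).mul_left ℓ
    refine Real.not_summable_one_div_natCast ((summable_nat_add_iff 1).1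
      (Summable.of_norm_bounded_eventually_nat hs ?_))
    filter_upwards [hlow] with k hk
    rwa [Real.norm_of_nonneg (by positivity)]
  have hone := measure_limsup_eq_one hFm (iIndepSet_epochCount_eq_zero hT hx0 hxm) hsum
  have hae : ∀ᵐ ω ∂P, ω ∈ limsup F atTop :=
    (mem_ae_iff_prob_eq_one (MeasurableSet.measurableSet_limsup hFm)).2 hone
  filter_upwards [hae, hT.strictMono, hT.tendsto_atTop] with ω hω hmono htop
  obtain ⟨k, hk⟩ := (mem_limsup_iff_frequently_mem.1 hω).exists
  exact (restartTime_le_of_epochCount_eq_zero hx.strictMonoOn (hT.zero ω) hmono htop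
    (hx.nonneg k) (hxm k.le_succ) (hx.work_sub k).ge hk).trans_lt (EReal.coe_lt_top _)

theorem measure_restartTime_eq_top_pos (hℓ : 0 < ℓ) (hrate : 0 < rate)
    (hT : IsPoissonProcess rate T P)
    (hr : ContinuousOn r (Ici 0)) (hpos : ∀ t, 0 < t → 0 < r t)
    (hint : Tendsto (work r) atTop atTop) {c : ℝ} (hc : 1 / ℓ < c)
    (hlim : ∀ᶠ t in atTop, c < rate / (r t * Real.log (work r t))) :
    0 < P {ω | restartTime r ℓ (fun n => T n ω) = ⊤} := by
  have hc0 : 0 < c := (one_div_pos.2 hℓ).trans hc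
  have hcℓ : 1 < c * ℓ := (div_lt_iff₀ hℓ).1 hc
  -- This is `c * ℓ * p / (p + 1) > 1`, the summability exponent in `hq`: the partial cell lost to
  -- rounding must not use up the margin `c * ℓ > 1`.
  obtain ⟨p, hp⟩ := exists_nat_gt (1 / (c * ℓ - 1))
  rw [div_lt_iff₀ (by linarith)] at hp
  have hp0 : 0 < p := by
    rcases Nat.eq_zero_or_pos p with h | h
    · simp [h] at hp; linarith
    · exact h
  set ε := ℓ / (p + 1) with hε
  have hε0 : 0 < ε := by positivity
  have hℓε : ℓ = (p + 1) * ε := by rw [hε]; field_simp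
  have hq : 1 < c * ε * p := by
    rw [hε, mul_div_assoc', div_mul_eq_mul_div, lt_div_iff₀ (by positivity)]
    linarith
  obtain ⟨x, hx⟩ := exists_isWorkMesh hr hpos hint hε0
  have hx0 := hx.nonneg 0
  have hxm := hx.strictMono.monotone
  set N : ℕ → Ω → ℕ := fun k ω => epochCount (fun n => T n ω) (x k) (x (k + 1))
  have hNm : ∀ k, Measurable (N k) := fun k => measurable_epochCount hT.measurable _ _
  have hind : iIndepFun N P := hT.indep_count x hx0 hxm
  have hFr : ∀ k, P.real (N k ⁻¹' {0}) = Real.exp (-(rate * (x (k + 1) - x k))) := fun k =>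
    measureReal_epochCount_eq_zero hT hrate.le (hx.nonneg k) (hxm k.le_succ)
  obtain ⟨U, hU⟩ := ((hlim.and (hint.eventually_gt_atTop 1)).and
    (eventually_gt_atTop 0)).exists_forall_of_atTop
  have hup : ∀ k : ℕ, U ≤ x k → P.real (N k ⁻¹' {0}) ≤ (k * ε) ^ (-(c * ε)) := by
    intro k hk
    have hk1 : x k ≤ x (k + 1) := hxm k.le_succ
    obtain ⟨⟨-, hW⟩, -⟩ := hU (x k) hk
    have hlog : 0 < Real.log (work r (x k)) := Real.log_pos hW
    have hbound : ∀ u ∈ Icc (x k) (x (k + 1)), r u ≤ rate / (c * Real.log (work r (x k))) := by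
      intro u hu
      obtain ⟨⟨h1, h2⟩, h3⟩ := hU u (hk.trans hu.1)
      have hru := hpos u h3
      have hll : Real.log (work r (x k)) ≤ Real.log (work r u) := Real.log_le_log (by linarith)
        (hx.strictMonoOn.monotoneOn (hx.nonneg _) h3.le hu.1)
      rw [lt_div_iff₀ (mul_pos hru (Real.log_pos h2))] at h1
      rw [le_div_iff₀ (by positivity)]
      calc r u * (c * Real.log (work r (x k))) = (c * r u) * Real.log (work r (x k)) := by ring
        _ ≤ (c * r u) * Real.log (work r u) := by gcongr
        _ ≤ rate := by linarith
    have h := work_sub_work_le hr (hx.nonneg k) hk1 hbound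
    rw [hx.work_sub, div_mul_eq_mul_div, le_div_iff₀ (by positivity)] at h
    rw [hFr, ← hx.work_eq, Real.rpow_def_of_pos (by linarith), Real.exp_le_exp]
    linarith
  set bad : ℕ → Set Ω := fun k => ⋂ j ∈ Finset.Ico k (k + p), N j ⁻¹' {0} with hbad
  have hbadr : ∀ᶠ k : ℕ in atTop,
      P.real (bad k) ≤ ε ^ (-(c * ε * p)) * (k : ℝ) ^ (-(c * ε * p)) := by
    filter_upwards [hx.tendsto_atTop.eventually_ge_atTop U, eventually_gt_atTop 0] with k hk hk0
    have hkε : 0 < k * ε := by positivity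
    have h1 : P.real (bad k) = ∏ j ∈ Finset.Ico k (k + p), P.real (N j ⁻¹' {0}) := by
      rw [measureReal_def, hbad, hind.measure_inter_preimage_eq_mul _
        (fun _ _ => measurableSet_singleton 0), ENNReal.toReal_prod]
      rfl
    have h2 : ∏ j ∈ Finset.Ico k (k + p), P.real (N j ⁻¹' {0}) ≤
        ∏ _j ∈ Finset.Ico k (k + p), (k * ε) ^ (-(c * ε)) := by
      refine Finset.prod_le_prod (fun _ _ => measureReal_nonneg) fun j hj => ?_
      have hkj := (Finset.mem_Ico.1 hj).1
      refine (hup j (hk.trans (hxm hkj))).trans ?_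
      refine Real.rpow_le_rpow_of_nonpos hkε ?_ (by nlinarith)
      gcongr
    rw [h1]
    refine h2.trans_eq ?_
    rw [Finset.prod_const, Nat.card_Ico, Nat.add_sub_cancel_left, ← Real.rpow_natCast,
      ← Real.rpow_mul hkε.le, Real.mul_rpow (Nat.cast_nonneg k) hε0.le, mul_comm]
    ring_nf
  have hsum : ∑' k, P (bad k) ≠ ⊤ := by
    have hs : Summable fun k => P.real (bad k) := by
      refine Summable.of_norm_bounded_eventually_nat
        ((Real.summable_nat_rpow.2 (neg_lt_neg hq)).mul_left (ε ^ (-(c * ε * p)))) ?_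
      filter_upwards [hbadr] with k hk
      rwa [Real.norm_of_nonneg measureReal_nonneg]
    have : ∀ k, P (bad k) = ENNReal.ofReal (P.real (bad k)) := fun k => by simp
    simp_rw [this]
    exact hs.tsum_ofReal_ne_top
  obtain ⟨K, hK⟩ := ((ENNReal.tendsto_sum_nat_add _ hsum).eventually_lt_const one_pos).exists
  -- `A` depends only on the cells before `K` and `B` only on the later ones, so they are
  -- independent. On `A ∩ B` no run of `p` empty cells starts anywhere, hence no attempt succeeds.
  set A : Set Ω := ⋂ j ∈ Finset.range K, N j ⁻¹' {0}ᶜ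
  set B : Set Ω := (⋃ k, bad (k + K))ᶜ with hB
  have hsub : ∀ (S : Set ℕ) (j : ℕ) (s : Set ℕ), j ∈ S →
      MeasurableSet[⨆ i ∈ S, MeasurableSpace.comap (N i) ⊤] (N j ⁻¹' s) := fun S j s hj =>
    (le_iSup₂ (f := fun i (_ : i ∈ S) => MeasurableSpace.comap (N i) ⊤) j hj) _
      ⟨s, trivial, rfl⟩
  have hAm : MeasurableSet[⨆ i ∈ {i | i < K}, MeasurableSpace.comap (N i) ⊤] A :=
    MeasurableSet.biInter (Finset.range K).countable_toSet fun j hj =>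
      hsub _ _ _ (Finset.mem_range.1 hj)
  have hBm : MeasurableSet[⨆ i ∈ {i | K ≤ i}, MeasurableSpace.comap (N i) ⊤] B := by
    refine (MeasurableSet.iUnion fun k => ?_).compl
    refine MeasurableSet.biInter (Finset.Ico (k + K) (k + K + p)).countable_toSet fun j hj =>
      hsub _ _ _ ?_
    have := (Finset.mem_Ico.1 hj).1
    exact (Nat.le_add_left K k).trans this
  have hdisj : Disjoint {i : ℕ | i < K} {i | K ≤ i} :=
    Set.disjoint_left.2 fun i (h1 : i < K) (h2 : K ≤ i) => absurd h1 (not_lt.2 h2)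
  have hAB : P (A ∩ B) = P A * P B :=
    (Indep_iff _ _ P).1 (indep_iSup_of_disjoint (fun i => (hNm i).comap_le) hind.iIndep hdisj)
      A B hAm hBm
  have hPA : P A ≠ 0 := by
    refine fun h => ?_
    have h1 := hT.measureReal_biInter_epochCount_ne_zero hrate.le hx0 hxm (Finset.range K)
    have h2 : P.real A = 0 := by rw [measureReal_def, h, ENNReal.toReal_zero]
    rw [h1, Finset.prod_eq_zero_iff] at h2
    obtain ⟨k, -, hk⟩ := h2
    have hk1 : x k < x (k + 1) := hx.strictMono k.lt_succ_self
    have : Real.exp (-(rate * (x (k + 1) - x k))) < 1 :=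
      Real.exp_lt_one_iff.2 (neg_lt_zero.2 (mul_pos hrate (sub_pos.2 hk1)))
    linarith
  have hPB : P B ≠ 0 := by
    have hBm' : MeasurableSet (⋃ k, bad (k + K)) := MeasurableSet.iUnion fun k =>
      MeasurableSet.biInter (Finset.countable_toSet _) fun j _ =>
        hNm j (measurableSet_singleton 0)
    rw [hB, prob_compl_eq_one_sub hBm']
    exact (tsub_pos_of_lt ((measure_iUnion_le _).trans_lt hK)).ne'
  have hpos' : 0 < P (A ∩ B) := by
    rw [hAB]
    exact pos_iff_ne_zero.2 (mul_ne_zero hPA hPB)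
  refine hpos'.trans_le (measure_mono_ae ?_)
  filter_upwards [hT.strictMono, hT.tendsto_atTop] with ω hmono htop hω
  by_contra hne
  obtain ⟨n, hn⟩ := exists_success_of_restartTime_ne_top hx.strictMonoOn (hT.zero ω) hmono hne
  rw [hℓε] at hn
  obtain ⟨k, -, hk⟩ := exists_empty_cells hx.strictMonoOn work_zero (hT.zero ω) hmono htop hε0
    hx.nonneg hx.work_eq hn
  rcases lt_or_ge k K with hkK | hkK
  · exact mem_iInter₂.1 hω.1 k (Finset.mem_range.2 hkK) (hk 0 hp0)
  · refine hω.2 (mem_iUnion.2 ⟨k - K, mem_iInter₂.2 fun j hj => ?_⟩)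
    rw [Nat.sub_add_cancel hkK, Finset.mem_Ico] at hj
    have := hk (j - k) (by omega)
    rwa [Nat.add_sub_cancel' hj.1] at this

end Finiteness

/-! ### Tail asymptotics for power rates -/

/-- The rounding errors `s` in the number of cells and the constants `L` in the logarithm of each
factor vanish in the limit. -/
theorem tendsto_mul_div_rpow_mul_log {α β b s L : ℝ} (hβ : 0 < β) :
    Tendsto (fun t : ℝ => (α * t ^ β + s) * (b * Real.log t - L) / (t ^ β * Real.log t)) atTop
      (𝓝 (α * b)) := by
  have h1 : Tendsto (fun t : ℝ => α + s * (t ^ β)⁻¹) atTop (𝓝 (α + s * 0)) :=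
    ((tendsto_rpow_atTop hβ).inv_tendsto_atTop.const_mul s).const_add α
  have h2 : Tendsto (fun t : ℝ => b - L * (Real.log t)⁻¹) atTop (𝓝 (b - L * 0)) :=
    (Real.tendsto_log_atTop.inv_tendsto_atTop.const_mul L).const_sub b
  have h := h1.mul h2
  rw [mul_zero, mul_zero, add_zero, sub_zero] at h
  refine h.congr' ?_
  filter_upwards [eventually_gt_atTop 1] with t ht
  have hl := (Real.log_pos ht).ne'
  have ht' := (Real.rpow_pos_of_pos (zero_lt_one.trans ht) β).ne'
  field_simp

theorem work_rpow {r : ℝ → ℝ} {a b : ℝ} (hb : 0 < b) (hrab : ∀ t : ℝ, 0 ≤ t → r t = a * t ^ b)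
    {t : ℝ} (ht : 0 ≤ t) : work r t = a / (b + 1) * t ^ (b + 1) := by
  have h : work r t = ∫ s in (0 : ℝ)..t, a * s ^ b := by
    refine intervalIntegral.integral_congr fun s hs => ?_
    rw [uIcc_of_le ht] at hs
    exact hrab s hs.1
  rw [h, intervalIntegral.integral_const_mul, integral_rpow (Or.inl (by linarith)),
    Real.zero_rpow (by linarith)]
  ring

section Tail

variable {Ω : Type*} [MeasurableSpace Ω] {P : Measure Ω} [IsProbabilityMeasure P]
  {ℓ rate : ℝ} {T : ℕ → Ω → ℝ} {r : ℝ → ℝ} {a b : ℝ}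

theorem measureReal_lt_restartDelay_le (hT : IsPoissonProcess rate T P)
    (hw : StrictMonoOn (work r) (Ici 0)) (t : ℝ) :
    P.real {ω | (t : EReal) < restartDelay r ℓ (fun n => T n ω)} ≤
      P.real {ω | (t : EReal) < restartTime r ℓ (fun n => T n ω)} := by
  refine ENNReal.toReal_mono (measure_ne_top _ _) (measure_mono_ae ?_)
  filter_upwards [hT.strictMono] with ω hmono hω
  exact lt_of_lt_of_le hω (restartDelay_le_restartTime hw (hT.zero ω) hmono)

/-- Only the cells inside `[δ * t, t]` are used: there `r ≥ a * (δ * t) ^ b`, so `1 - exp (-y) ≤ y`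
bounds every factor by `C * t ^ (-b)`. The discarded cells cost the factor `1 - δ ^ (b + 1)`; the
`-2` pays for the ceiling and the floor. -/
theorem eventually_measureReal_lt_restartTime_le (hℓ : 0 < ℓ) (hrate : 0 < rate)
    (hT : IsPoissonProcess rate T P)
    (hr : ContinuousOn r (Ici 0)) (hpos : ∀ t, 0 < t → 0 < r t)
    (hint : Tendsto (work r) atTop atTop) (ha : 0 < a) (hb : 0 < b)
    (hrab : ∀ t : ℝ, 0 ≤ t → r t = a * t ^ b) {δ : ℝ} (hδ : 0 < δ) (hδ1 : δ < 1) :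
    ∃ L : ℝ, ∀ᶠ t : ℝ in atTop,
      P.real {ω | (t : EReal) < restartTime r ℓ (fun n => T n ω)} ≤
        Real.exp (-(((1 - δ ^ (b + 1)) * (a / (b + 1)) / ℓ * t ^ (b + 1) + -2) *
          (b * Real.log t - L))) := by
  obtain ⟨x, hx⟩ := exists_isWorkMesh hr hpos hint hℓ
  have hxm := hx.strictMono.monotone
  set C : ℝ := rate * ℓ / (a * δ ^ b) with hC
  have hδb : 0 < δ ^ b := Real.rpow_pos_of_pos hδ b
  have hC0 : 0 < C := by positivity
  refine ⟨Real.log C, ?_⟩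
  filter_upwards [eventually_gt_atTop 0, (Real.tendsto_log_atTop.const_mul_atTop hb
    |>.eventually_ge_atTop (Real.log C))] with t ht hlog
  have hδt : 0 < δ * t := mul_pos hδ ht
  have htb : 0 < t ^ b := Real.rpow_pos_of_pos ht b
  set K₁ := ⌈work r (δ * t) / ℓ⌉₊ with hK₁
  set K₂ := ⌊work r t / ℓ⌋₊ with hK₂
  have hwt := work_rpow hb hrab ht.le
  have hwδ := work_rpow hb hrab hδt.le
  have hwt0 : 0 ≤ work r t := by rw [hwt]; positivity
  have hwδ0 : 0 ≤ work r (δ * t) := by rw [hwδ]; positivity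
  have hK₂le : K₂ * ℓ ≤ work r t := (le_div_iff₀ hℓ).1 (Nat.floor_le (div_nonneg hwt0 hℓ.le))
  have hK₁le : work r (δ * t) ≤ K₁ * ℓ := (div_le_iff₀ hℓ).1 (Nat.le_ceil _)
  have hsub : P.real {ω | (t : EReal) < restartTime r ℓ (fun n => T n ω)} ≤
      P.real (⋂ k ∈ Finset.Ico K₁ K₂,
        (fun ω => epochCount (fun n => T n ω) (x k) (x (k + 1))) ⁻¹' {0}ᶜ) := by
    refine ENNReal.toReal_mono (measure_ne_top _ _) (measure_mono_ae ?_)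
    filter_upwards [hT.strictMono, hT.tendsto_atTop] with ω hmono htop hω
    refine mem_iInter₂.2 fun k hk h0 => ?_
    have hle := restartTime_le_of_epochCount_eq_zero hx.strictMonoOn (hT.zero ω) hmono htop
      (hx.nonneg k) (hxm k.le_succ) (hx.work_sub k).ge h0
    have hkt : x (k + 1) ≤ t := by
      rw [hx.ge_iff ht.le]
      refine le_trans ?_ hK₂le
      have : ((k + 1 : ℕ) : ℝ) ≤ K₂ := by exact_mod_cast (Finset.mem_Ico.1 hk).2
      gcongr
    exact (lt_of_lt_of_le hω hle).not_ge (EReal.coe_le_coe_iff.2 hkt)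
  have hq : C * (t ^ b)⁻¹ = Real.exp (Real.log C - b * Real.log t) := by
    rw [Real.exp_sub, Real.exp_log hC0, mul_comm b, ← Real.rpow_def_of_pos ht, div_eq_mul_inv]
  refine hsub.trans ?_
  rw [hT.measureReal_biInter_epochCount_ne_zero hrate.le (hx.nonneg 0) hxm]
  have hprod : ∏ k ∈ Finset.Ico K₁ K₂, (1 - Real.exp (-(rate * (x (k + 1) - x k)))) ≤
      ∏ _k ∈ Finset.Ico K₁ K₂, Real.exp (Real.log C - b * Real.log t) := by
    refine Finset.prod_le_prod (fun k _ => ?_) fun k hk => ?_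
    · have hk1 : x k ≤ x (k + 1) := hxm k.le_succ
      rw [sub_nonneg, Real.exp_le_one_iff]
      exact neg_nonpos.2 (mul_nonneg hrate.le (sub_nonneg.2 hk1))
    · have hk1 : x k ≤ x (k + 1) := hxm k.le_succ
      have hδk : δ * t ≤ x k := by
        rw [hx.le_iff hδt.le]
        refine hK₁le.trans ?_
        have : (K₁ : ℝ) ≤ k := by exact_mod_cast (Finset.mem_Ico.1 hk).1
        gcongr
      have h := le_work_sub_work (M := a * (δ * t) ^ b) hr (hx.nonneg k) hk1 fun u hu => by
        rw [hrab u (hδt.le.trans (hδk.trans hu.1))]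
        have := hδk.trans hu.1
        gcongr
      rw [hx.work_sub, Real.mul_rpow hδ.le ht.le] at h
      have h2 := Real.add_one_le_exp (-(rate * (x (k + 1) - x k)))
      rw [← hq, hC, div_mul_eq_mul_div, ← div_eq_mul_inv, div_div]
      refine le_trans (by linarith : _ ≤ rate * (x (k + 1) - x k)) ?_
      rw [le_div_iff₀ (by positivity)]
      nlinarith
  refine hprod.trans ?_
  rw [Finset.prod_const, Nat.card_Ico, ← Real.exp_nat_mul, Real.exp_le_exp]
  have hcard : (1 - δ ^ (b + 1)) * (a / (b + 1)) / ℓ * t ^ (b + 1) + -2 ≤ ((K₂ - K₁ : ℕ) : ℝ) := by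
    have h1 := Nat.lt_floor_add_one (work r t / ℓ)
    have h2 := Nat.ceil_lt_add_one (div_nonneg hwδ0 hℓ.le)
    have h3 : (K₂ : ℝ) - K₁ ≤ ((K₂ - K₁ : ℕ) : ℝ) := by
      rw [sub_le_iff_le_add]
      exact_mod_cast le_tsub_add
    have h4 : (1 - δ ^ (b + 1)) * (a / (b + 1)) / ℓ * t ^ (b + 1) =
        work r t / ℓ - work r (δ * t) / ℓ := by
      rw [hwt, hwδ, Real.mul_rpow hδ.le ht.le]
      ring
    rw [h4]
    linarith
  nlinarith

theorem eventually_le_measureReal_lt_restartDelay (hℓ : 0 < ℓ) (hrate : 0 < rate)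
    (hT : IsPoissonProcess rate T P)
    (hr : ContinuousOn r (Ici 0)) (hpos : ∀ t, 0 < t → 0 < r t)
    (hint : Tendsto (work r) atTop atTop) (ha : 0 < a) (hb : 0 < b)
    (hrab : ∀ t : ℝ, 0 ≤ t → r t = a * t ^ b) {p : ℕ} (hp : 0 < p) :
    ∃ L : ℝ, ∀ᶠ t : ℝ in atTop,
      Real.exp (-((a / (b + 1) / (p * (ℓ / (p + 1))) * t ^ (b + 1) + 2) *
          (b * Real.log t - L))) ≤
        P.real {ω | (t : EReal) < restartDelay r ℓ (fun n => T n ω)} := by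
  set ε := ℓ / (p + 1) with hε
  have hε0 : 0 < ε := by positivity
  have hℓε : ℓ = (p + 1) * ε := by rw [hε]; field_simp
  obtain ⟨x, hx⟩ := exists_isWorkMesh hr hpos hint hε0
  have hxm := hx.strictMono.monotone
  have h2b : (0 : ℝ) < 2 ^ b := Real.rpow_pos_of_pos two_pos b
  set C : ℝ := rate * ε / (a * 2 ^ b) / 2 with hC
  have hC0 : 0 < C := by positivity
  refine ⟨Real.log C, ?_⟩
  filter_upwards [eventually_gt_atTop 0, (Real.tendsto_log_atTop.const_mul_atTop hb
    |>.eventually_ge_atTop (Real.log C)), hint.eventually_ge_atTop ℓ,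
    (tendsto_rpow_atTop hb).eventually_ge_atTop (rate * ε / (a * 2 ^ b))] with t ht hlog htℓ htb1
  have htb : 0 < t ^ b := Real.rpow_pos_of_pos ht b
  have hpε : 0 < p * ε := by positivity
  -- The smallest convenient choice with `x (K * p) > t`; the `K + 1` cells used give the `+ 2` in
  -- the exponent.
  set K := ⌊work r t / (p * ε)⌋₊ + 1 with hK
  have hwt := work_rpow hb hrab ht.le
  have hwt0 : 0 ≤ work r t := hℓ.le.trans htℓ
  have hKlt : work r t < K * (p * ε) := by
    rw [← div_lt_iff₀ hpε, hK]
    push_cast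
    exact Nat.lt_floor_add_one _
  have hKle : (K : ℝ) ≤ work r t / (p * ε) + 1 := by
    rw [hK]
    push_cast
    linarith [Nat.floor_le (div_nonneg hwt0 hpε.le)]
  -- The last cell used ends with work at most `work r t + (p + 1) * ε`, that is `work r t + ℓ`, so
  -- all cells end by `2 * t` and `r ≤ a * (2 * t) ^ b` on them.
  have hw2 : work r t + ℓ ≤ work r (2 * t) := by
    have h : (2 : ℝ) ≤ 2 ^ (b + 1) := by
      simpa using Real.rpow_le_rpow_of_exponent_le (one_le_two : (1 : ℝ) ≤ 2)
        (by linarith : (1 : ℝ) ≤ b + 1)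
    have h' : work r (2 * t) = 2 ^ (b + 1) * work r t := by
      rw [work_rpow hb hrab (by positivity), hwt, Real.mul_rpow two_pos.le ht.le]
      ring
    rw [h']
    nlinarith
  set S : Finset ℕ := (Finset.range (K + 1)).image (· * p) with hS
  have hcard : S.card = K + 1 := by
    rw [hS, Finset.card_image_of_injective _ (mul_left_injective₀ hp.ne'), Finset.card_range]
  have hsub : P.real (⋂ k ∈ S,
        (fun ω => epochCount (fun n => T n ω) (x k) (x (k + 1))) ⁻¹' {0}ᶜ) ≤
      P.real {ω | (t : EReal) < restartDelay r ℓ (fun n => T n ω)} := by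
    refine ENNReal.toReal_mono (measure_ne_top _ _) (measure_mono_ae ?_)
    filter_upwards [hT.strictMono, hT.tendsto_atTop] with ω hmono htop hω
    have hle := le_restartDelay_of_cells_nonempty hx.strictMonoOn work_zero (hT.zero ω) hmono htop
      hε0 hx.nonneg hx.work_eq hp (K := K) fun i hi => mem_iInter₂.1 hω (i * p)
        (Finset.mem_image_of_mem _ (Finset.mem_range.2 (Nat.lt_succ_of_le hi)))
    rw [← hℓε] at hle
    refine lt_of_lt_of_le (EReal.coe_lt_coe_iff.2 ?_) hle
    rw [← not_le, hx.ge_iff ht.le, not_le]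
    push_cast
    linarith
  have hq : C * (t ^ b)⁻¹ = Real.exp (Real.log C - b * Real.log t) := by
    rw [Real.exp_sub, Real.exp_log hC0, mul_comm b, ← Real.rpow_def_of_pos ht, div_eq_mul_inv]
  refine le_trans ?_ hsub
  rw [hT.measureReal_biInter_epochCount_ne_zero hrate.le (hx.nonneg 0) hxm]
  have hprod : ∏ _k ∈ S, Real.exp (Real.log C - b * Real.log t) ≤
      ∏ k ∈ S, (1 - Real.exp (-(rate * (x (k + 1) - x k)))) := by
    refine Finset.prod_le_prod (fun k _ => (Real.exp_pos _).le) fun k hk => ?_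
    have hk1 : x k ≤ x (k + 1) := hxm k.le_succ
    have hk2 : x (k + 1) ≤ 2 * t := by
      obtain ⟨i, hi, rfl⟩ := Finset.mem_image.1 hk
      have hiK : (i : ℝ) ≤ K := by exact_mod_cast Nat.lt_succ_iff.1 (Finset.mem_range.1 hi)
      rw [hx.ge_iff (by positivity)]
      push_cast
      have h1 : (i : ℝ) * (p * ε) ≤ (work r t / (p * ε) + 1) * (p * ε) :=
        mul_le_mul_of_nonneg_right (hiK.trans hKle) hpε.le
      rw [add_mul, div_mul_cancel₀ _ hpε.ne'] at h1
      nlinarith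
    have h := work_sub_work_le (M := a * (2 * t) ^ b) hr (hx.nonneg k) hk1 fun u hu => by
      have hu0 := (hx.nonneg k).trans hu.1
      rw [hrab u hu0]
      have := hu.2.trans hk2
      gcongr
    rw [hx.work_sub, Real.mul_rpow two_pos.le ht.le] at h
    set y := rate * ε / (a * 2 ^ b) / t ^ b with hy
    have hy0 : 0 ≤ y := by positivity
    have hy1 : y ≤ 1 := by rwa [hy, div_le_one htb]
    have hyd : y ≤ rate * (x (k + 1) - x k) := by
      rw [hy, div_div, div_le_iff₀ (by positivity)]
      nlinarith
    -- For `0 ≤ y ≤ 1`, `exp (-y) ≤ 1 / (1 + y) ≤ 1 - y / 2`; this is the factor `1 / 2` in `C`.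
    have hexp : Real.exp (-(rate * (x (k + 1) - x k))) ≤ 1 - y / 2 := by
      refine (Real.exp_le_exp.2 (neg_le_neg hyd)).trans ?_
      rw [Real.exp_neg]
      refine (inv_anti₀ (by positivity) (Real.add_one_le_exp y)).trans ?_
      rw [inv_le_iff_one_le_mul₀ (by positivity)]
      nlinarith
    rw [← hq]
    have : C * (t ^ b)⁻¹ = y / 2 := by rw [hC, hy]; ring
    linarith
  refine le_trans ?_ hprod
  rw [Finset.prod_const, hcard, ← Real.exp_nat_mul, Real.exp_le_exp]
  have hKle' : ((K + 1 : ℕ) : ℝ) ≤ a / (b + 1) / (p * ε) * t ^ (b + 1) + 2 := by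
    have : a / (b + 1) / (p * ε) * t ^ (b + 1) = work r t / (p * ε) := by rw [hwt]; ring
    rw [this]
    push_cast
    linarith
  nlinarith

/-- Both tails are `exp (-(κ + o(1)) t ^ (b + 1) log t)` with `κ = a b / ((b + 1) ℓ)`. -/
theorem tendsto_log_tail (hℓ : 0 < ℓ) (hrate : 0 < rate) (hT : IsPoissonProcess rate T P)
    (hr : ContinuousOn r (Ici 0)) (hpos : ∀ t, 0 < t → 0 < r t)
    (hint : Tendsto (work r) atTop atTop) (ha : 0 < a) (hb : 0 < b)
    (hrab : ∀ t : ℝ, 0 ≤ t → r t = a * t ^ b) {f : ℝ → ℝ}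
    (hf : ∀ t : ℝ, P.real {ω | (t : EReal) < restartDelay r ℓ (fun n => T n ω)} ≤ f t)
    (hf' : ∀ t : ℝ, f t ≤ P.real {ω | (t : EReal) < restartTime r ℓ (fun n => T n ω)}) :
    (∀ᶠ t in atTop, 0 < f t) ∧
      Tendsto (fun t => -Real.log (f t) / (t ^ (b + 1) * Real.log t)) atTop
        (𝓝 (a * b / (b + 1) / ℓ)) := by
  have hβ : 0 < b + 1 := by linarith
  have hposf : ∀ᶠ t in atTop, 0 < f t := by
    obtain ⟨L, hL⟩ := eventually_le_measureReal_lt_restartDelay hℓ hrate hT hr hpos hint ha hb hrab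
      one_pos
    filter_upwards [hL] with t ht
    exact ((Real.exp_pos _).trans_le ht).trans_le (hf t)
  refine ⟨hposf, tendsto_order.2 ⟨fun y hy => ?_, fun y hy => ?_⟩⟩
  -- The upper bound on the tail of `X` has a constant tending to the claimed one as `δ → 0`.
  · have hlim : Tendsto (fun δ : ℝ => (1 - δ ^ (b + 1)) * (a / (b + 1)) / ℓ * b) (𝓝[>] 0)
        (𝓝 (a * b / (b + 1) / ℓ)) := by
      have hc : ContinuousAt (fun δ : ℝ => (1 - δ ^ (b + 1)) * (a / (b + 1)) / ℓ * b) 0 := by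
        have := Real.continuousAt_rpow_const 0 (b + 1) (Or.inr hβ.le)
        fun_prop
      have := hc.tendsto.mono_left (nhdsWithin_le_nhds (s := Ioi 0))
      rw [Real.zero_rpow hβ.ne'] at this
      convert this using 2
      ring
    obtain ⟨δ, hδy, hδ0, hδ1⟩ := ((hlim.eventually_const_lt hy).and
      (Ioo_mem_nhdsGT (zero_lt_one' ℝ))).exists
    obtain ⟨L, hL⟩ := eventually_measureReal_lt_restartTime_le hℓ hrate hT hr hpos hint ha hb hrab
      hδ0 hδ1
    filter_upwards [hL, hposf, eventually_gt_atTop 1,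
      (tendsto_mul_div_rpow_mul_log (s := -2) (L := L) hβ).eventually_const_lt hδy]
      with t h1 h2 h3 h4
    have h5 : 0 < t ^ (b + 1) * Real.log t :=
      mul_pos (Real.rpow_pos_of_pos (by linarith) _) (Real.log_pos h3)
    have h6 := Real.log_le_log h2 ((hf' t).trans h1)
    rw [Real.log_exp] at h6
    exact h4.trans_le (div_le_div_of_nonneg_right (by linarith) h5.le)
  -- The lower bound on the tail of `D` has the constant inflated by `1 + 1 / p`, removed by `p →
  -- ∞`.
  · have hlim : Tendsto (fun p : ℕ => (a * b / (b + 1) / ℓ) * (1 + (p : ℝ)⁻¹)) atTop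
        (𝓝 (a * b / (b + 1) / ℓ)) := by
      simpa using (tendsto_inv_atTop_nhds_zero_nat (𝕜 := ℝ)).const_add 1 |>.const_mul
        (a * b / (b + 1) / ℓ)
    obtain ⟨p, hpy, hp⟩ := ((hlim.eventually_lt_const hy).and (eventually_gt_atTop 0)).exists
    have hp' : a / (b + 1) / (p * (ℓ / (p + 1))) * b < y := by
      refine lt_of_eq_of_lt ?_ hpy
      have : (p : ℝ) ≠ 0 := by positivity
      field_simp
    obtain ⟨L, hL⟩ := eventually_le_measureReal_lt_restartDelay hℓ hrate hT hr hpos hint ha hb hrab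
      hp
    filter_upwards [hL, eventually_gt_atTop 1,
      (tendsto_mul_div_rpow_mul_log (s := 2) (L := L) hβ).eventually_lt_const hp']
      with t h1 h3 h4
    have h5 : 0 < t ^ (b + 1) * Real.log t :=
      mul_pos (Real.rpow_pos_of_pos (by linarith) _) (Real.log_pos h3)
    have h6 := Real.log_le_log (Real.exp_pos _) (h1.trans (hf t))
    rw [Real.log_exp] at h6
    exact (div_le_div_of_nonneg_right (by linarith) h5.le).trans_lt h4

end Tail

theorem mainTheorem12 {Ω : Type*} [MeasurableSpace Ω] (P : Measure Ω) [IsProbabilityMeasure P]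
    (ℓ : ℝ) (hℓ : 0 < ℓ)
    (rate : ℝ) (hrate : 0 < rate)
    (T : ℕ → Ω → ℝ) (hT : IsPoissonProcess rate T P)
    (r : ℝ → ℝ) (hr_cont : ContinuousOn r (Set.Ici 0)) (hr_pos : ∀ t : ℝ, 0 < t → 0 < r t)
    (hr_int : Tendsto (work r) atTop atTop) :
    (limsup (fun t : ℝ => ((rate / (r t * Real.log (work r t)) : ℝ) : EReal)) atTop
          < ((1 / ℓ : ℝ) : EReal) →
        ∀ᵐ ω ∂P, restartTime r ℓ (fun n => T n ω) < ⊤) ∧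
    (((1 / ℓ : ℝ) : EReal)
          < liminf (fun t : ℝ => ((rate / (r t * Real.log (work r t)) : ℝ) : EReal)) atTop →
        0 < P {ω | restartTime r ℓ (fun n => T n ω) = ⊤}) ∧
    (∀ a b : ℝ, 0 < a → 0 < b → (∀ t : ℝ, 0 ≤ t → r t = a * t ^ b) →
        LogAsymp (fun t => P.real {ω | (t : EReal) < restartTime r ℓ (fun n => T n ω)})
            (fun t => P.real {ω | (t : EReal) < restartDelay r ℓ (fun n => T n ω)}) ∧
          LogAsymp (fun t => P.real {ω | (t : EReal) < restartDelay r ℓ (fun n => T n ω)})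
            (fun t => Real.exp (-(a * b / (b + 1) * t ^ (b + 1) * Real.log t / ℓ)))) := by
  refine ⟨fun h => ?_, fun h => ?_, fun a b ha hb hrab => ?_⟩
  · refine ae_restartTime_lt_top hℓ hrate hT hr_cont hr_pos hr_int ?_
    filter_upwards [eventually_lt_of_limsup_lt h] with t ht
    exact EReal.coe_lt_coe_iff.1 ht
  · obtain ⟨c, hc, hc'⟩ := EReal.lt_iff_exists_real_btwn.1 h
    refine measure_restartTime_eq_top_pos hℓ hrate hT hr_cont hr_pos hr_int
      (EReal.coe_lt_coe_iff.1 hc) ?_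
    filter_upwards [eventually_lt_of_lt_liminf hc'] with t ht
    exact EReal.coe_lt_coe_iff.1 ht
  -- The squeeze is applied at its two extremes, `f` being the tail of `X` and then that of `D`; the
  -- common nonzero limit gives both ratios.
  · have hle := measureReal_lt_restartDelay_le (ℓ := ℓ) hT (strictMonoOn_work hr_cont hr_pos)
    obtain ⟨hX0, hX⟩ := tendsto_log_tail hℓ hrate hT hr_cont hr_pos hr_int ha hb hrab hle
      fun t => le_rfl
    obtain ⟨hD0, hD⟩ := tendsto_log_tail hℓ hrate hT hr_cont hr_pos hr_int ha hb hrab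
      (fun t => le_rfl) hle
    have hκ : a * b / (b + 1) / ℓ ≠ 0 := by positivity
    refine ⟨⟨hX0, hD0, ?_⟩, hD0, Eventually.of_forall fun t => Real.exp_pos _, ?_⟩
    · have h := hX.div hD hκ
      rw [div_self hκ] at h
      refine h.congr' ?_
      filter_upwards [eventually_gt_atTop 1] with t ht
      have h5 : t ^ (b + 1) * Real.log t ≠ 0 :=
        (mul_pos (Real.rpow_pos_of_pos (by linarith) _) (Real.log_pos ht)).ne'
      rw [Pi.div_apply, div_div_div_cancel_right₀ h5, neg_div_neg_eq]
    · have h := hD.div_const (a * b / (b + 1) / ℓ)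
      rw [div_self hκ] at h
      refine h.congr fun t => ?_
      rw [Real.log_exp, div_div, neg_div, ← div_neg]
      congr 1
      ring
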